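/- For a finite simple graph $G$ with vertices $v_1,\dots,v_n$ of degrees $d_1,\dots,d_n$, let $A(G)$ be its adjacency matrix and let $\mathcal{S}(G)$ be its Sombor matrix, the real symmetric $n\times n$ matrix whose $(i,j)$-entry is $\sqrt{d_i^2+d_j^2}$ if $v_i$ and $v_j$ are adjacent and $0$ otherwise. Let $E_A(G)$ (the energy of $G$) and $\mathcal{E}(G)$ (the Sombor energy of $G$) denote the sums of the absolute values of the eigenvalues, counted with multiplicity, of $A(G)$ and of $\mathcal{S}(G)$, respectively. Let $P_n$ be the path with $n$ vertices. Let $T_n$ be a tree with $n\ge 3$ vertices and maximum degree $\Delta$. Then $$2\sqrt{2n-2}<\mathcal{E}(T_n)<\sqrt2\,\Delta\,E_A(P_n)=\begin{cases} 2\sqrt{2}\,\Delta\csc\dfrac{\pi}{2(n+1)}-2\sqrt{2}\,\Delta, & \text{if } n \text{ is even},\\[2mm] 2\sqrt{2}\,\Delta\cot\dfrac{\pi}{2(n+1)}-2\sqrt{2}\,\Delta, & \text{if } n \text{ is odd}. \end{cases}$$ -/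

import Mathlib

noncomputable section

/-- The energy of a real symmetric matrix: the sum of the absolute values of its eigenvalues,
counted with multiplicity. -/
def matrixEnergy {V : Type*} [Fintype V] [DecidableEq V] {M : Matrix V V ℝ}
    (hM : M.IsHermitian) : ℝ :=
  ∑ i, |hM.eigenvalues i|

/-- The Sombor matrix of a graph: the `(u, v)` entry is `√(d_u² + d_v²)` if `u` and `v` are
adjacent, and `0` otherwise. -/
def somborMatrix {V : Type*} [Fintype V] (G : SimpleGraph V) [DecidableRel G.Adj] :
    Matrix V V ℝ :=
  Matrix.of fun u v =>
    if G.Adj u v then √((G.degree u : ℝ) ^ 2 + (G.degree v : ℝ) ^ 2) else 0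

theorem somborMatrix_isHermitian {V : Type*} [Fintype V] (G : SimpleGraph V)
    [DecidableRel G.Adj] : (somborMatrix G).IsHermitian := by
  ext u v
  simp [somborMatrix, G.adj_comm u v, add_comm]

theorem adjMatrix_real_isHermitian {V : Type*} (G : SimpleGraph V)
    [DecidableRel G.Adj] : (G.adjMatrix ℝ).IsHermitian := by
  ext u v
  simp [G.adj_comm u v]

/-- The Sombor energy of a graph. -/
def somborEnergy {V : Type*} [Fintype V] [DecidableEq V] (G : SimpleGraph V)
    [DecidableRel G.Adj] : ℝ :=
  matrixEnergy (somborMatrix_isHermitian G)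

/-- The (adjacency) energy of a graph. -/
def adjEnergy {V : Type*} [Fintype V] [DecidableEq V] (G : SimpleGraph V)
    [DecidableRel G.Adj] : ℝ :=
  matrixEnergy (adjMatrix_real_isHermitian G)

instance pathGraphDecidableRel (n : ℕ) : DecidableRel (SimpleGraph.pathGraph n).Adj :=
  fun _ _ => decidable_of_iff _ SimpleGraph.pathGraph_adj.symm

/-- The cosecant. -/
def csc (x : ℝ) : ℝ := 1 / Real.sin x

end

/-! Lower bound: the Sombor matrix S has trace zero, so no eigenvalue exceeds half the energy in
absolute value, and the squared energy is at least 2 tr S². On an edge ij the squared entry is at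
least d_i² + 1, so tr S² ≥ ∑ d_i (d_i² + 1) ≥ 2 ∑ d_i = 4(n - 1), strictly because some vertex has
degree at least 2.

Upper bound: ∫ log(1 + (xt)²)/t² over t > 0 is a constant times |x|, so energies can be compared
through ∏ (1 + (x_i t)²) = det(1 + t²S²) (`sum_abs_lt_of_prod_lt`). A tree is bipartite; signing the
rows of S by the two colours gives a skew-symmetric K with K² = -S², and the determinant becomes
det(1 + tK)². Deleting a pendant vertex v with neighbour u from a forest gives the matching
recurrence D(s) = D(s - v) + t² K_uv² D(s - v - u). Every weight is at most c = 2Δ²t², and constant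
weight c gives exactly the recurrence of the path. The inequality is strict because an edge at a
leaf has weight at most (Δ² + 1)t² < c.

The path has eigenvalues 2 cos(kπ/(n + 1)); their absolute values are summed by reflection and
telescoping. -/

/-! ### Pendant-vertex expansion of determinants -/

section Determinants

open Matrix

variable {V : Type*} [Fintype V] [DecidableEq V]

/-- If row `u` of `M` is the standard basis vector, column `u` may be cleared. -/
theorem det_eq_det_updateCol_of_row_eq_single {R : Type*} [CommRing R] (M : Matrix V V R) (u : V)
    (h : M u = Pi.single u 1) : M.det = (M.updateCol u (Pi.single u 1)).det := by
  have h1 : M.updateRow u (Pi.single u 1) = M := by rw [← h, updateRow_eq_self]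
  -- Both determinants are the `(u, u)` cofactor, read off from `M` and from its transpose.
  have h2 := congr_fun₂ (adjugate_transpose M) u u
  rw [transpose_apply, adjugate_apply, adjugate_apply, h1, updateRow_transpose,
    det_transpose] at h2
  exact h2

/-- The determinant of `1 + K'`, where `K'` is obtained from `K` by replacing all the entries
outside `s × s` by zero. It is the determinant of the principal submatrix of `1 + K` on `s`. -/
def principalDet {R : Type*} [CommRing R] (K : Matrix V V R) (s : Finset V) : R :=
  (1 + Matrix.of fun i j => if i ∈ s ∧ j ∈ s then K i j else 0 : Matrix V V R).det

theorem principalDet_univ {R : Type*} [CommRing R] (K : Matrix V V R) :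
    principalDet K Finset.univ = (1 + K).det := by
  unfold principalDet
  congr 2
  ext i j
  simp

theorem principalDet_eq_one {R : Type*} [CommRing R] (K : Matrix V V R) (s : Finset V)
    (h : ∀ i ∈ s, ∀ j ∈ s, K i j = 0) : principalDet K s = 1 := by
  have : (Matrix.of fun i j => if i ∈ s ∧ j ∈ s then K i j else 0 : Matrix V V R) = 0 := by
    ext i j
    simp only [of_apply, Matrix.zero_apply, ite_eq_right_iff]
    exact fun hij => h i hij.1 j hij.2
  rw [principalDet, this, add_zero, det_one]

/-- Expansion of a principal determinant along a pendant vertex `v` with neighbour `u`. -/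
theorem principalDet_pendant {R : Type*} [CommRing R] (K : Matrix V V R) (s : Finset V) {u v : V}
    (hu : u ∈ s) (hv : v ∈ s) (huv : u ≠ v) (hrow : ∀ j ∈ s, j ≠ u → K v j = 0)
    (hcol : ∀ j ∈ s, j ≠ u → K j v = 0) :
    principalDet K s = principalDet K (s.erase v) -
      K u v * K v u * principalDet K ((s.erase v).erase u) := by
  set M : Matrix V V R := 1 + Matrix.of fun i j => if i ∈ s ∧ j ∈ s then K i j else 0 with hM
  have hMv : M v = Pi.single v 1 + K v u • Pi.single u 1 := by
    ext j
    simp only [hM, Matrix.add_apply, one_apply, of_apply, hv, true_and, Pi.add_apply, Pi.smul_apply,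
      Pi.single_apply, smul_eq_mul]
    by_cases hju : j = u
    · subst hju
      simp [hu, huv, huv.symm]
    · by_cases hjs : j ∈ s
      · simp [hju, hjs, hrow j hjs hju, eq_comm]
      · simp [hju, hjs, eq_comm]
  have hMcol : ∀ j, j ≠ u → j ≠ v → M j v = 0 := by
    intro j hju hjv
    by_cases hjs : j ∈ s
    · simp [hM, one_apply, hjv, hjs, hcol j hjs hju]
    · simp [hM, one_apply, hjv, hjs]
  have hsplit : M.det = (M.updateRow v (Pi.single v 1)).det +
      K v u * (M.updateRow v (Pi.single u 1)).det := by
    rw [← det_updateRow_smul, ← det_updateRow_add, ← hMv, updateRow_eq_self]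
  have hfirst : (M.updateRow v (Pi.single v 1)).det = principalDet K (s.erase v) := by
    rw [det_eq_det_updateCol_of_row_eq_single _ v (by simp), principalDet]
    congr 1
    ext i j
    by_cases hj : j = v
    · subst hj
      by_cases hi : i = j <;> simp [hi, one_apply]
    · by_cases hi : i = v
      · subst hi
        simp [hj, one_apply, Ne.symm hj]
      · simp [hi, hj, hM]
  have hsecond : (M.updateRow v (Pi.single u 1)).det =
      -(K u v * principalDet K ((s.erase v).erase u)) := by
    set B := M.updateRow v (Pi.single u 1) with hB
    have hBcol : B = B.updateCol v (K u v • Pi.single u 1) := by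
      ext i j
      by_cases hj : j = v
      · subst hj
        by_cases hi : i = j
        · subst hi
          simp [hB, huv]
        · by_cases hiu : i = u
          · subst hiu
            simp [hB, hi, hM, hu, hv, one_apply]
          · simp [hB, hi, hiu, hMcol i hiu hi]
      · simp [hj]
    rw [hBcol, det_updateCol_smul, ← mul_neg]
    congr 1
    set C := B.updateCol v (Pi.single u 1) with hC
    -- After the swap, row `u` is the basis vector of `u` and column `v` that of `v`, so column `u`
    -- and row `v` can be cleared; the swap accounts for the minus sign.
    have hswap : C.det = -(C.submatrix (Equiv.swap u v) id).det := by
      rw [det_permute, Equiv.Perm.sign_swap huv]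
      simp
    rw [hswap]
    congr 1
    have hrowu : (C.submatrix (Equiv.swap u v) id) u = Pi.single u 1 := by
      ext j
      by_cases hj : j = v
      · subst hj
        simp [hC, huv.symm]
      · simp [hC, hj, hB]
    rw [det_eq_det_updateCol_of_row_eq_single _ u hrowu]
    set C' := (C.submatrix (Equiv.swap u v) id).updateCol u (Pi.single u 1) with hC'
    have hcolv : C'ᵀ v = Pi.single v 1 := by
      ext j
      simp only [transpose_apply, hC', ne_eq, huv.symm, not_false_eq_true, updateCol_ne,
        submatrix_apply, id, hC, updateCol_self, Pi.single_apply]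
      congr 1
      rw [eq_iff_iff, Equiv.swap_apply_eq_iff, Equiv.swap_apply_left]
    rw [← det_transpose, det_eq_det_updateCol_of_row_eq_single _ v hcolv, principalDet,
      ← det_transpose]
    congr 1
    ext i j
    by_cases hi : i = v
    · subst hi
      by_cases hj : j = i
      · subst hj
        simp
      · simp [hj, one_apply, Ne.symm hj]
    · rw [transpose_apply, updateCol_ne hi, transpose_apply]
      by_cases hj : j = v
      · subst hj
        have h := congr_fun hcolv i
        rw [transpose_apply] at h
        simp [h, one_apply, hi]
      · by_cases hju : j = u
        · subst hju
          simp [hC', one_apply, Pi.single_apply]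
        · by_cases hiu : i = u
          · subst hiu
            simp [hC', hju, hC, hj, hB, one_apply, Ne.symm hju]
          · simp [hC', hiu, hC, hi, hB, hj, hju, hM, Equiv.swap_apply_of_ne_of_ne]
  change M.det = _
  rw [hsplit, hfirst, hsecond]
  ring

end Determinants

/-! ### Coulson-type integral and comparison of energies -/

section Energy

open MeasureTheory Set

theorem integrableOn_log_one_add_sq_div_sq :
    IntegrableOn (fun t : ℝ => Real.log (1 + t ^ 2) / t ^ 2) (Ioi 0) := by
  have hmeas : Measurable fun t : ℝ => Real.log (1 + t ^ 2) / t ^ 2 := by fun_prop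
  have hnn : ∀ t : ℝ, 0 ≤ Real.log (1 + t ^ 2) / t ^ 2 := fun t =>
    div_nonneg (Real.log_nonneg (by nlinarith [sq_nonneg t])) (sq_nonneg t)
  rw [← Ioc_union_Ioi_eq_Ioi (zero_le_one' ℝ)]
  refine IntegrableOn.union ?_ ?_
  · refine Integrable.mono' (g := fun _ => (1 : ℝ)) (by simp) hmeas.aestronglyMeasurable ?_
    refine ae_of_all _ fun t => ?_
    rw [Real.norm_of_nonneg (hnn t)]
    refine div_le_one_of_le₀ ?_ (sq_nonneg t)
    have := Real.log_le_sub_one_of_pos (show 0 < 1 + t ^ 2 by positivity)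
    linarith
  -- For large `t`, `1 + t ^ 2 ≤ (1 + √t) ^ 4` bounds the logarithm by `4 * √t`, hence the integrand
  -- by `4 * t ^ (-3/2)`.
  · have hint : IntegrableOn (fun t : ℝ => 4 * t ^ (-(3 / 2) : ℝ)) (Ioi 1) :=
      (integrableOn_Ioi_rpow_of_lt (by norm_num) one_pos).const_mul 4
    refine Integrable.mono' hint hmeas.aestronglyMeasurable ?_
    refine (ae_restrict_iff' measurableSet_Ioi).2 (ae_of_all _ fun t ht => ?_)
    have ht0 : (0 : ℝ) < t := lt_trans one_pos ht
    rw [Real.norm_of_nonneg (hnn t), div_le_iff₀ (by positivity)]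
    have hpow : 4 * t ^ (-(3 / 2) : ℝ) * t ^ 2 = 4 * √t := by
      rw [mul_assoc, ← Real.rpow_natCast t 2, ← Real.rpow_add ht0, Real.sqrt_eq_rpow]
      norm_num
    rw [hpow]
    have hs := Real.sqrt_nonneg t
    have h1 : 1 + t ^ 2 ≤ (1 + √t) ^ 4 := by
      have hsq : √t ^ 4 = t ^ 2 := by
        rw [show (4 : ℕ) = 2 * 2 from rfl, pow_mul, Real.sq_sqrt ht0.le]
      rw [← hsq]
      have : (1 + √t) ^ 4 = 1 + √t ^ 4 + (4 * √t + 6 * √t ^ 2 + 4 * √t ^ 3) := by ring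
      rw [this]
      have : 0 ≤ 4 * √t + 6 * √t ^ 2 + 4 * √t ^ 3 := by positivity
      linarith
    calc Real.log (1 + t ^ 2) ≤ Real.log ((1 + √t) ^ 4) := Real.log_le_log (by positivity) h1
      _ = 4 * Real.log (1 + √t) := by rw [Real.log_pow]; norm_num
      _ ≤ 4 * √t := by
        have := Real.log_le_sub_one_of_pos (show 0 < 1 + √t by positivity)
        linarith

theorem integrableOn_log_one_add_mul_sq_div_sq (x : ℝ) :
    IntegrableOn (fun t : ℝ => Real.log (1 + (x * t) ^ 2) / t ^ 2) (Ioi 0) := by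
  rcases eq_or_ne x 0 with rfl | hx
  · simp
  have hx' : 0 < |x| := abs_pos.2 hx
  have h := (integrableOn_Ioi_comp_mul_left_iff
    (fun t : ℝ => Real.log (1 + t ^ 2) / t ^ 2) 0 hx').2
    (by simpa using integrableOn_log_one_add_sq_div_sq)
  refine (h.const_mul (x ^ 2)).congr (ae_of_all _ fun t => ?_)
  simp only [mul_pow, sq_abs]
  field_simp

/-- Substituting `|x| * t` for the variable leaves one factor `|x|`: this is how absolute values of
eigenvalues arise from an integral. -/
theorem integral_log_one_add_mul_sq_div_sq (x : ℝ) :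
    ∫ t in Ioi (0 : ℝ), Real.log (1 + (x * t) ^ 2) / t ^ 2 =
      |x| * ∫ t in Ioi (0 : ℝ), Real.log (1 + t ^ 2) / t ^ 2 := by
  rcases eq_or_ne x 0 with rfl | hx
  · simp
  have hx' : 0 < |x| := abs_pos.2 hx
  have h := integral_comp_mul_left_Ioi
    (fun t : ℝ => Real.log (1 + t ^ 2) / t ^ 2) 0 hx'
  rw [mul_zero, smul_eq_mul] at h
  have h2 : ∀ t : ℝ, Real.log (1 + (x * t) ^ 2) / t ^ 2 =
      |x| ^ 2 * (Real.log (1 + (|x| * t) ^ 2) / (|x| * t) ^ 2) := by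
    intro t
    simp only [mul_pow, sq_abs]
    field_simp
  simp_rw [h2]
  rw [integral_const_mul, h]
  field_simp

theorem setIntegral_Ioi_lt {f g : ℝ → ℝ} (hf : IntegrableOn f (Ioi 0)) (hg : IntegrableOn g (Ioi 0))
    (h : ∀ t > 0, f t < g t) : ∫ t in Ioi (0 : ℝ), f t < ∫ t in Ioi (0 : ℝ), g t := by
  have hpos : 0 < ∫ t in Ioi (0 : ℝ), (g t - f t) := by
    rw [integral_pos_iff_support_of_nonneg_ae
      ((ae_restrict_iff' measurableSet_Ioi).2 (ae_of_all _ fun t ht => (sub_pos.2 (h t ht)).le))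
      (hg.sub hf)]
    have hsub : Ioi (0 : ℝ) ⊆ Function.support (fun t => g t - f t) := fun t ht =>
      (sub_pos.2 (h t ht)).ne'
    rw [Measure.restrict_apply' measurableSet_Ioi, inter_eq_self_of_subset_right hsub]
    simp
  rw [integral_sub hg hf] at hpos
  linarith

theorem integrableOn_sum_log_one_add_mul_sq_div_sq {ι : Type*} [Fintype ι] (x : ι → ℝ) :
    IntegrableOn (fun t : ℝ => ∑ i, Real.log (1 + (x i * t) ^ 2) / t ^ 2) (Ioi 0) :=
  integrable_finsetSum _ fun i _ => integrableOn_log_one_add_mul_sq_div_sq (x i)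

theorem integral_sum_log_one_add_mul_sq_div_sq {ι : Type*} [Fintype ι] (x : ι → ℝ) :
    ∫ t in Ioi (0 : ℝ), ∑ i, Real.log (1 + (x i * t) ^ 2) / t ^ 2 =
      (∑ i, |x i|) * ∫ t in Ioi (0 : ℝ), Real.log (1 + t ^ 2) / t ^ 2 := by
  rw [integral_finsetSum _ fun i _ => integrableOn_log_one_add_mul_sq_div_sq (x i),
    Finset.sum_mul]
  exact Finset.sum_congr rfl fun i _ => integral_log_one_add_mul_sq_div_sq (x i)

/-- A comparison principle of Coulson type: the sum of the absolute values of a family of reals is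
strictly monotone in the polynomial `∏ i, (1 + (x i * t) ^ 2)`. -/
theorem sum_abs_lt_of_prod_lt {ι κ : Type*} [Fintype ι] [Fintype κ] (x : ι → ℝ) (y : κ → ℝ)
    (h : ∀ t > 0, ∏ i, (1 + (x i * t) ^ 2) < ∏ j, (1 + (y j * t) ^ 2)) :
    ∑ i, |x i| < ∑ j, |y j| := by
  -- Nonnegativity suffices: a strict inequality between products may be cancelled by a nonnegative
  -- factor.
  have hC : 0 ≤ ∫ t in Ioi (0 : ℝ), Real.log (1 + t ^ 2) / t ^ 2 :=
    integral_nonneg fun t =>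
      div_nonneg (Real.log_nonneg (by nlinarith [sq_nonneg t])) (sq_nonneg t)
  have hlt := setIntegral_Ioi_lt (integrableOn_sum_log_one_add_mul_sq_div_sq x)
    (integrableOn_sum_log_one_add_mul_sq_div_sq y) fun t ht => by
      rw [← Finset.sum_div, ← Finset.sum_div,
        ← Real.log_prod fun i _ => (show (0 : ℝ) < 1 + (x i * t) ^ 2 by positivity).ne',
        ← Real.log_prod fun i _ => (show (0 : ℝ) < 1 + (y i * t) ^ 2 by positivity).ne']
      exact div_lt_div_of_pos_right
        (Real.log_lt_log (Finset.prod_pos fun i _ => by positivity) (h t ht)) (pow_pos ht 2)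
  rw [integral_sum_log_one_add_mul_sq_div_sq, integral_sum_log_one_add_mul_sq_div_sq] at hlt
  exact lt_of_mul_lt_mul_right hlt hC

end Energy

/-! ### Eigenvalues, traces and signed determinants -/

section Spectrum

open Matrix

variable {V : Type*} [Fintype V] [DecidableEq V]

theorem det_one_add_smul_mul_self {S : Matrix V V ℝ} (hS : S.IsHermitian) (t : ℝ) :
    (1 + t ^ 2 • (S * S)).det = ∏ i, (1 + (hS.eigenvalues i * t) ^ 2) := by
  have h : 1 + t ^ 2 • (S * S) = Unitary.conjStarAlgAut ℝ _ hS.eigenvectorUnitary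
      (diagonal fun i => 1 + (hS.eigenvalues i * t) ^ 2) := by
    have hd : (diagonal fun i => 1 + (hS.eigenvalues i * t) ^ 2) =
        1 + t ^ 2 • (diagonal hS.eigenvalues * diagonal hS.eigenvalues) := by
      rw [diagonal_mul_diagonal, ← diagonal_one, ← diagonal_smul, diagonal_add]
      congr 1
      ext i
      simp
      ring
    rw [hd, map_add, map_one, map_smul, map_mul]
    have := hS.spectral_theorem
    simp only [RCLike.ofReal_real_eq_id, Function.id_comp] at this
    rw [← this]
  rw [h, Unitary.conjStarAlgAut_apply, det_mul_comm, ← mul_assoc,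
    Unitary.coe_star_mul_self, one_mul, det_diagonal]

theorem sum_sq_eigenvalues {S : Matrix V V ℝ} (hS : S.IsHermitian) :
    ∑ i, hS.eigenvalues i ^ 2 = (S * S).trace := by
  have := hS.spectral_theorem
  simp only [RCLike.ofReal_real_eq_id, Function.id_comp] at this
  conv_rhs => rw [this]
  rw [← map_mul, Unitary.conjStarAlgAut_apply, trace_mul_comm, ← mul_assoc,
    Unitary.coe_star_mul_self, one_mul, diagonal_mul_diagonal, trace_diagonal]
  simp [sq]

/-- The energy of a matrix with zero trace is bounded below by its Frobenius norm. -/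
theorem two_mul_trace_sq_le_energy_sq {S : Matrix V V ℝ} (hS : S.IsHermitian) (h0 : S.trace = 0) :
    2 * (S * S).trace ≤ matrixEnergy hS ^ 2 := by
  have h0' : ∑ i, hS.eigenvalues i = 0 := by
    have := hS.trace_eq_sum_eigenvalues
    rw [h0] at this
    simpa using this.symm
  rw [← sum_sq_eigenvalues hS, matrixEnergy]
  set x := hS.eigenvalues
  -- Trace zero makes `x i` minus the sum of the other eigenvalues, so `|x i|` is at most the sum of
  -- their absolute values.
  have h1 : ∀ i, 2 * |x i| ≤ ∑ j, |x j| := by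
    intro i
    have ha := Finset.add_sum_erase Finset.univ x (Finset.mem_univ i)
    have hb := Finset.add_sum_erase Finset.univ (fun j => |x j|) (Finset.mem_univ i)
    have hc := Finset.abs_sum_le_sum_abs x (Finset.univ.erase i)
    rw [h0'] at ha
    rw [show ∑ j ∈ Finset.univ.erase i, x j = - x i by linarith, abs_neg] at hc
    linarith
  calc 2 * ∑ i, x i ^ 2 = ∑ i, (2 * |x i|) * |x i| := by
        rw [Finset.mul_sum]
        exact Finset.sum_congr rfl fun i _ => by rw [mul_assoc, abs_mul_abs_self]; ring
    _ ≤ ∑ i, (∑ j, |x j|) * |x i| :=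
        Finset.sum_le_sum fun i _ => mul_le_mul_of_nonneg_right (h1 i) (abs_nonneg _)
    _ = (∑ j, |x j|) ^ 2 := by rw [← Finset.mul_sum, sq]

/-- Signing a symmetric matrix whose support is bipartite gives a skew-symmetric matrix. -/
theorem det_one_add_smul_mul_self_of_signing {S : Matrix V V ℝ} (hS : S.IsHermitian) (σ : V → ℝ)
    (hσ1 : ∀ i, σ i ^ 2 = 1)
    (hσ : ∀ i j, S i j ≠ 0 → σ j = -σ i) (t : ℝ) :
    (1 + t ^ 2 • (S * S)).det = (1 + t • of fun i j => σ i * S i j).det ^ 2 := by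
  set K : Matrix V V ℝ := of fun i j => σ i * S i j with hK
  have hsymm : ∀ i j, S j i = S i j := fun i j => by simpa using hS.apply i j
  have hskew : Kᵀ = -K := by
    ext i j
    simp only [hK, transpose_apply, of_apply, Matrix.neg_apply, hsymm i j]
    by_cases h : S i j = 0
    · simp [h]
    · rw [hσ i j h]
      ring
  have hsq : K * K = -(S * S) := by
    ext i j
    simp only [hK, Matrix.mul_apply, of_apply, Matrix.neg_apply, ← Finset.sum_neg_distrib]
    refine Finset.sum_congr rfl fun k _ => ?_
    by_cases h : S i k = 0
    · simp [h]
    · rw [hσ i k h]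
      linear_combination (-(S i k * S k j)) * hσ1 i
  -- Transposition exchanges 1 + tK and 1 - tK, whose product is 1 - t²K² = 1 + t²S².
  have hdet : (1 - t • K).det = (1 + t • K).det := by
    rw [← det_transpose (1 + t • K), transpose_add, transpose_smul, hskew, transpose_one,
      smul_neg, sub_eq_add_neg]
  rw [sq (det _)]
  nth_rewrite 1 [← hdet]
  rw [← det_mul]
  congr 1
  rw [sub_mul, mul_add, mul_add, one_mul, mul_one, one_mul, smul_mul_smul_comm, hsq]
  rw [smul_neg, sq]
  abel

end Spectrum

/-! ### Determinants of weighted forests and the path bound -/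

section Forest

open Matrix

/-- The matching generating polynomial of the path with `n` vertices, each edge of weight `c`. -/
def pathMatchingPoly (c : ℝ) : ℕ → ℝ
  | 0 => 1
  | 1 => 1
  | n + 2 => pathMatchingPoly c (n + 1) + c * pathMatchingPoly c n

theorem one_le_pathMatchingPoly {c : ℝ} (hc : 0 ≤ c) : ∀ n, 1 ≤ pathMatchingPoly c n
  | 0 => le_rfl
  | 1 => le_rfl
  | n + 2 => by
    have h1 := one_le_pathMatchingPoly hc (n + 1)
    have h2 := one_le_pathMatchingPoly hc n
    rw [pathMatchingPoly]
    nlinarith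

/-- A finite vertex set of a forest which spans an edge contains a vertex with exactly one
neighbour in the set. -/
theorem SimpleGraph.IsAcyclic.exists_pendant {V : Type*} {G : SimpleGraph V} (hG : G.IsAcyclic)
    (s : Finset V) (hs : ∃ i ∈ s, ∃ j ∈ s, G.Adj i j) :
    ∃ u ∈ s, ∃ v ∈ s, G.Adj u v ∧ ∀ j ∈ s, j ≠ u → ¬ G.Adj v j := by
  classical
  obtain ⟨i, hi, j, hj, hij⟩ := hs
  set H := G.induce (s : Set V) with hH
  have hHa : H.IsAcyclic := hG.induce _
  have hadj : H.Adj ⟨i, hi⟩ ⟨j, hj⟩ := hij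
  -- The component containing the edge is a nontrivial tree. A leaf of it is pendant in all of `s`,
  -- since its neighbours in `s` lie in the same component.
  set C := H.connectedComponentMk ⟨i, hi⟩ with hC
  have hT := hHa.isTree_connectedComponent C
  have hiC : (⟨i, hi⟩ : (s : Set V)) ∈ C.supp := rfl
  have hjC : (⟨j, hj⟩ : (s : Set V)) ∈ C.supp :=
    (SimpleGraph.ConnectedComponent.eq.2 hadj.reachable.symm)
  have : Nontrivial C.supp := ⟨⟨⟨_, hiC⟩, ⟨_, hjC⟩, fun h => hadj.ne (congrArg Subtype.val h)⟩⟩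
  obtain ⟨v, hv⟩ := hT.exists_vert_degree_one_of_nontrivial
  rw [SimpleGraph.degree_eq_one_iff_existsUnique_adj] at hv
  obtain ⟨u, hu, huniq⟩ := hv
  refine ⟨u.1.1, u.1.2, v.1.1, v.1.2, hu.symm, fun k hk hku hvk => hku ?_⟩
  have hvk' : H.Adj v.1 ⟨k, hk⟩ := hvk
  have hkC : (⟨k, hk⟩ : (s : Set V)) ∈ C.supp := by
    have : v.1 ∈ C.supp := v.2
    rw [SimpleGraph.ConnectedComponent.mem_supp_iff] at this ⊢
    rw [← this]
    exact SimpleGraph.ConnectedComponent.eq.2 hvk'.reachable.symm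
  have := huniq ⟨_, hkC⟩ hvk'
  rw [← this]

variable {V : Type*} [Fintype V] [DecidableEq V]

/-- The principal determinants of a skew-symmetric matrix supported on a forest are at most those
of the path with the same number of vertices. -/
theorem principalDet_le_pathMatchingPoly {G : SimpleGraph V} (hG : G.IsAcyclic)
    (K : Matrix V V ℝ) (hK : ∀ i j, K j i = -K i j) (hsupp : ∀ i j, ¬ G.Adj i j → K i j = 0)
    {c : ℝ} (hc : ∀ i j, K i j ^ 2 ≤ c) (hc0 : 0 ≤ c) (s : Finset V) :
    1 ≤ principalDet K s ∧ principalDet K s ≤ pathMatchingPoly c s.card := by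
  induction s using Finset.strongInduction with
  | H s ih =>
    by_cases hs : ∃ i ∈ s, ∃ j ∈ s, G.Adj i j
    · obtain ⟨u, hu, v, hv, huv, hj⟩ := hG.exists_pendant s hs
      rw [principalDet_pendant K s hu hv huv.ne (fun j hjs hju => hsupp _ _ (hj j hjs hju))
        (fun j hjs hju => hsupp _ _ fun h => hj j hjs hju h.symm)]
      have hu' : u ∈ s.erase v := Finset.mem_erase.2 ⟨huv.ne, hu⟩
      have h1 := ih _ (Finset.erase_ssubset hv)
      have h2 := ih _ ((Finset.erase_ssubset hu').trans (Finset.erase_ssubset hv))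
      obtain ⟨m, hm⟩ : ∃ m, s.card = m + 2 := by
        have := Finset.one_lt_card.2 ⟨u, hu, v, hv, huv.ne⟩
        exact ⟨s.card - 2, by omega⟩
      have c1 : (s.erase v).card = m + 1 := by rw [Finset.card_erase_of_mem hv, hm]; rfl
      have c2 : ((s.erase v).erase u).card = m := by
        rw [Finset.card_erase_of_mem hu', c1]; rfl
      rw [c1] at h1
      rw [c2] at h2
      -- Skew symmetry turns `-K u v * K v u` into `K u v ^ 2`, so both sides obey the same
      -- recurrence. The lower bound `1` in the induction provides the sign needed to multiply
      -- inequalities.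
      rw [hm, pathMatchingPoly, hK u v]
      have hcuv := hc u v
      have hsq := sq_nonneg (K u v)
      constructor
      · nlinarith [mul_nonneg hsq (zero_le_one.trans h2.1)]
      · nlinarith [mul_le_mul hcuv h2.2 (zero_le_one.trans h2.1) hc0]
    · push Not at hs
      rw [principalDet_eq_one K s fun i hi j hj => hsupp i j (hs i hi j hj)]
      exact ⟨le_rfl, one_le_pathMatchingPoly hc0 _⟩

/-- Strict form of the comparison for a tree one of whose pendant edges has smaller weight. -/
theorem det_lt_pathMatchingPoly {G : SimpleGraph V} (hG : G.IsAcyclic)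
    (K : Matrix V V ℝ) (hK : ∀ i j, K j i = -K i j) (hsupp : ∀ i j, ¬ G.Adj i j → K i j = 0)
    {c : ℝ} (hc : ∀ i j, K i j ^ 2 ≤ c) {u v : V} (huv : G.Adj u v)
    (hv : ∀ j, G.Adj v j → j = u) (hlt : K u v ^ 2 < c) :
    1 ≤ (1 + K).det ∧ (1 + K).det < pathMatchingPoly c (Fintype.card V) := by
  have hc0 : 0 ≤ c := (sq_nonneg _).trans hlt.le
  refine ⟨principalDet_univ K ▸
    (principalDet_le_pathMatchingPoly hG K hK hsupp hc hc0 Finset.univ).1, ?_⟩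
  rw [← principalDet_univ, principalDet_pendant K _ (Finset.mem_univ u) (Finset.mem_univ v) huv.ne
    (fun j _ hju => hsupp _ _ fun h => hju (hv j h))
    (fun j _ hju => hsupp _ _ fun h => hju (hv j h.symm))]
  have hu' : u ∈ Finset.univ.erase v := Finset.mem_erase.2 ⟨huv.ne, Finset.mem_univ u⟩
  have h1 := principalDet_le_pathMatchingPoly hG K hK hsupp hc hc0 (Finset.univ.erase v)
  have h2 := principalDet_le_pathMatchingPoly hG K hK hsupp hc hc0
    ((Finset.univ.erase v).erase u)
  obtain ⟨m, hm⟩ : ∃ m, Fintype.card V = m + 2 := by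
    have := Fintype.one_lt_card_iff.2 ⟨u, v, huv.ne⟩
    exact ⟨Fintype.card V - 2, by omega⟩
  have c1 : (Finset.univ.erase v).card = m + 1 := by
    rw [Finset.card_erase_of_mem (Finset.mem_univ v), Finset.card_univ, hm]; rfl
  have c2 : ((Finset.univ.erase v).erase u).card = m := by
    rw [Finset.card_erase_of_mem hu', c1]; rfl
  rw [c1] at h1
  rw [c2] at h2
  rw [hm, pathMatchingPoly, hK u v]
  nlinarith [mul_le_mul_of_nonneg_left h2.2 hc0,
    mul_lt_mul_of_pos_right hlt (zero_lt_one.trans_le h2.1)]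

end Forest

/-! ### The path attains the bound -/

section Path

open Matrix SimpleGraph

/-- The signed determinant of the path is its matching generating polynomial. -/
theorem det_signed_pathGraph (n : ℕ) (σ : Fin n → ℝ) (hσ1 : ∀ i, σ i ^ 2 = 1)
    (hσ : ∀ i j, (pathGraph n).Adj i j → σ j = -σ i) (t : ℝ) :
    (1 + t • of fun i j => σ i * (pathGraph n).adjMatrix ℝ i j).det =
      pathMatchingPoly (t ^ 2) n := by
  set K : Matrix (Fin n) (Fin n) ℝ := t • of fun i j => σ i * (pathGraph n).adjMatrix ℝ i j with hK
  -- In an initial segment the last vertex is pendant, and removing it and its neighbour leaves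
  -- shorter initial segments.
  have key : ∀ m ≤ n, principalDet K (Finset.univ.filter fun i => i.1 < m) =
      pathMatchingPoly (t ^ 2) m := by
    intro m
    induction m using Nat.strong_induction_on with
    | _ m ih =>
      intro hm
      match m, ih, hm with
      | 0, _, _ => exact principalDet_eq_one _ _ (by simp)
      | 1, _, _ =>
        refine principalDet_eq_one _ _ fun i hi j hj => ?_
        have : i = j := by
          simp at hi hj
          ext
          omega
        simp [hK, this]
      | m + 2, ih, hm =>
        have e1 : (Finset.univ.filter fun i : Fin n => i.1 < m + 2).erase ⟨m + 1, by omega⟩ =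
            Finset.univ.filter fun i : Fin n => i.1 < m + 1 := by
          ext i
          simp [Fin.ext_iff]
          omega
        have e2 : (Finset.univ.filter fun i : Fin n => i.1 < m + 1).erase ⟨m, by omega⟩ =
            Finset.univ.filter fun i : Fin n => i.1 < m := by
          ext i
          simp [Fin.ext_iff]
          omega
        have hnadj : ∀ j : Fin n, j.1 < m + 2 → j ≠ ⟨m, by omega⟩ →
            ¬ (pathGraph n).Adj ⟨m + 1, by omega⟩ j := by
          intro j hj hjm
          rw [Ne, Fin.ext_iff] at hjm
          rw [pathGraph_adj]
          simp at hjm ⊢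
          omega
        have hadj : (pathGraph n).Adj ⟨m, by omega⟩ ⟨m + 1, by omega⟩ := by
          rw [pathGraph_adj]
          simp
        rw [principalDet_pendant K _ (u := ⟨m, by omega⟩) (v := ⟨m + 1, by omega⟩) (by simp)
          (by simp) (by simp) ?_ ?_, e1, e2, ih (m + 1) (by omega) (by omega),
          ih m (by omega) (by omega), pathMatchingPoly]
        · have := hσ1 ⟨m, by omega⟩
          simp [hK, hadj, hadj.symm, hσ _ _ hadj]
          left
          linear_combination t ^ 2 * this
        · intro j hj hjm
          simp [hK, hnadj j (by simpa using hj) hjm]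
        · intro j hj hjm
          have := hnadj j (by simpa using hj) hjm
          rw [adj_comm] at this
          simp [hK, this]
  have h := key n le_rfl
  rw [← h, ← principalDet_univ]
  congr 1
  ext i
  simp

end Path

/-! ### Spectrum and energy of the path -/

section PathEnergy

open Matrix SimpleGraph

/-- The zero values at `0` and `n + 1` stand for the missing neighbours of the two endpoints, so the
three-term formula holds at every vertex. -/
theorem pathGraph_adjMatrix_mulVec (n : ℕ) (f : ℕ → ℝ) (h0 : f 0 = 0) (hn : f (n + 1) = 0)
    (i : Fin n) :
    ((pathGraph n).adjMatrix ℝ *ᵥ fun j => f (j + 1)) i = f i + f (i + 2) := by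
  have h1 : ∑ j : Fin n, (if j.1 + 1 = i.1 then f (j + 1) else 0) = f i := by
    by_cases hi : i.1 = 0
    · rw [hi, h0]
      exact Finset.sum_eq_zero fun j _ => if_neg (by omega)
    · rw [Finset.sum_eq_single (⟨i.1 - 1, by omega⟩ : Fin n)]
      · rw [if_pos (by simp; omega)]
        congr 1
        simp
        omega
      · intro j _ hj
        rw [Ne, Fin.ext_iff] at hj
        simp at hj
        exact if_neg (by omega)
      · simp
  have h2 : ∑ j : Fin n, (if i.1 + 1 = j.1 then f (j + 1) else 0) = f (i + 2) := by
    by_cases hi : i.1 + 1 = n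
    · rw [show i.1 + 2 = n + 1 by omega, hn]
      exact Finset.sum_eq_zero fun j _ => if_neg (by omega)
    · rw [Finset.sum_eq_single (⟨i.1 + 1, by omega⟩ : Fin n)]
      · simp
      · intro j _ hj
        rw [Ne, Fin.ext_iff] at hj
        simp at hj
        exact if_neg (by omega)
      · simp
  rw [← h1, ← h2, ← Finset.sum_add_distrib, mulVec, dotProduct]
  refine Finset.sum_congr rfl fun j _ => ?_
  simp only [adjMatrix_apply, pathGraph_adj]
  by_cases ha : j.1 + 1 = i.1
  · have hb : ¬ i.1 + 1 = j.1 := by omega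
    simp [ha, hb]
  · by_cases hb : i.1 + 1 = j.1 <;> simp [ha, hb]

/-- The numbers `2 cos ((k + 1) π / (n + 1))` are eigenvalues of the path. -/
theorem two_mul_cos_mem_spectrum_pathGraph (n : ℕ) (k : Fin n) :
    2 * Real.cos ((k + 1) * (Real.pi / (n + 1))) ∈ spectrum ℝ ((pathGraph n).adjMatrix ℝ) := by
  set θ : ℝ := (k + 1) * (Real.pi / (n + 1)) with hθ
  have hn0 : (0 : ℝ) < n + 1 := by positivity
  have hpos : 0 < θ := by positivity
  have hlt : θ < Real.pi := by
    have : ((k : ℕ) : ℝ) + 1 < n + 1 := by exact_mod_cast Nat.succ_lt_succ k.2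
    rw [hθ, ← mul_div_assoc, div_lt_iff₀ hn0, mul_comm]
    exact mul_lt_mul_of_pos_left this Real.pi_pos
  rw [← Matrix.spectrum_toLin']
  apply Module.End.HasEigenvalue.mem_spectrum
  refine Module.End.hasEigenvalue_of_hasEigenvector
    -- The sine wave vanishes at `0` and, since `(n + 1) * θ` is a multiple of π, at `n + 1`. Its
    -- first entry `sin θ` is nonzero because `0 < θ < π`.
    (x := fun j : Fin n => Real.sin (((j + 1 : ℕ) : ℝ) * θ)) ⟨?_, ?_⟩
  · rw [Module.End.mem_eigenspace_iff, toLin'_apply]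
    ext i
    rw [pathGraph_adjMatrix_mulVec n (fun j => Real.sin ((j : ℝ) * θ)) (by simp) ?_]
    · simp only [Pi.smul_apply, smul_eq_mul]
      push_cast
      rw [show (i : ℝ) * θ = (i + 1) * θ - θ by ring, show ((i : ℝ) + 2) * θ = (i + 1) * θ + θ by ring,
        Real.sin_add, Real.sin_sub]
      ring
    · have : ((n + 1 : ℕ) : ℝ) * θ = ((k + 1 : ℕ) : ℝ) * Real.pi := by
        rw [hθ]
        push_cast
        field_simp
      rw [this, Real.sin_nat_mul_pi]
  · intro h
    have := congr_fun h ⟨0, k.pos⟩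
    simp at this
    exact (Real.sin_pos_of_pos_of_lt_pi hpos hlt).ne' this

/-- Cosine is injective on [0, π], so the `n` known eigenvalues are distinct and exhaust the `n`
eigenvalue indices. -/
theorem adjEnergy_pathGraph (n : ℕ) :
    adjEnergy (pathGraph n) =
      ∑ k ∈ Finset.range n, |2 * Real.cos (((k : ℝ) + 1) * (Real.pi / (n + 1)))| := by
  set hA := adjMatrix_real_isHermitian (pathGraph n)
  have hex : ∀ k : Fin n, ∃ i, hA.eigenvalues i =
      2 * Real.cos ((k + 1) * (Real.pi / (n + 1))) := by
    intro k
    have := two_mul_cos_mem_spectrum_pathGraph n k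
    rwa [hA.spectrum_real_eq_range_eigenvalues] at this
  choose e he using hex
  have hn0 : (0 : ℝ) < n + 1 := by positivity
  have hmem : ∀ k : Fin n, ((k : ℝ) + 1) * (Real.pi / (n + 1)) ∈ Set.Icc 0 Real.pi := by
    intro k
    have : ((k : ℕ) : ℝ) + 1 ≤ n + 1 := by exact_mod_cast (Nat.succ_lt_succ k.2).le
    refine ⟨by positivity, ?_⟩
    rw [← mul_div_assoc, div_le_iff₀ hn0, mul_comm]
    exact mul_le_mul_of_nonneg_left this Real.pi_pos.le
  have hinj : Function.Injective e := by
    intro a b hab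
    have h1 := he a
    rw [hab, he b] at h1
    have h2 := Real.injOn_cos (hmem b) (hmem a) (by linarith)
    have h3 : (0 : ℝ) < Real.pi / (n + 1) := by positivity
    have h4 := mul_right_cancel₀ h3.ne' h2
    ext
    have h5 : ((b : ℕ) : ℝ) = (a : ℕ) := by linarith
    exact_mod_cast h5.symm
  have hbij : Function.Bijective e := Finite.injective_iff_bijective.1 hinj
  rw [Finset.sum_range, adjEnergy, matrixEnergy, ← hbij.sum_comp]
  exact Finset.sum_congr rfl fun k _ => by rw [he k]

/-- Telescoping: 2 cos((k+1)θ) sin(θ/2) = sin((k+3/2)θ) - sin((k+1/2)θ). -/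
theorem sum_two_mul_cos_mul_sin_half (θ : ℝ) (m : ℕ) :
    (∑ k ∈ Finset.range m, 2 * Real.cos (((k : ℝ) + 1) * θ)) * Real.sin (θ / 2) =
      Real.sin ((m + 1 / 2) * θ) - Real.sin (θ / 2) := by
  induction m with
  | zero =>
    rw [Finset.sum_range_zero, zero_mul, Nat.cast_zero, show (0 + 1 / 2) * θ = θ / 2 by ring,
      sub_self]
  | succ m ih =>
    rw [Finset.sum_range_succ, add_mul, ih]
    push_cast
    rw [show ((m : ℝ) + 1 + 1 / 2) * θ = (m + 1) * θ + θ / 2 by ring,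
      show ((m : ℝ) + 1 / 2) * θ = (m + 1) * θ - θ / 2 by ring, Real.sin_add, Real.sin_sub]
    ring

theorem sum_range_symm_even (g : ℕ → ℝ) (m : ℕ) (hg : ∀ k < m, g (2 * m - 1 - k) = g k) :
    ∑ k ∈ Finset.range (2 * m), g k = 2 * ∑ k ∈ Finset.range m, g k := by
  rw [two_mul m, Finset.sum_range_add, ← Finset.sum_range_reflect (fun k => g (m + k)), two_mul]
  congr 1
  refine Finset.sum_congr rfl fun k hk => ?_
  rw [← hg k (Finset.mem_range.1 hk)]
  congr 1
  have := Finset.mem_range.1 hk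
  omega

theorem sum_range_symm_odd (g : ℕ → ℝ) (m : ℕ) (hg : ∀ k < m, g (2 * m - k) = g k) :
    ∑ k ∈ Finset.range (2 * m + 1), g k = 2 * ∑ k ∈ Finset.range m, g k + g m := by
  rw [show 2 * m + 1 = (m + 1) + m by ring, Finset.sum_range_add, Finset.sum_range_succ,
    ← Finset.sum_range_reflect (fun k => g (m + 1 + k))]
  have : ∑ k ∈ Finset.range m, g (m + 1 + (m - 1 - k)) = ∑ k ∈ Finset.range m, g k := by
    refine Finset.sum_congr rfl fun k hk => ?_
    rw [← hg k (Finset.mem_range.1 hk)]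
    congr 1
    have := Finset.mem_range.1 hk
    omega
  rw [this]
  ring

/-- The energy of the path. -/
theorem adjEnergy_pathGraph_eq (n : ℕ) :
    adjEnergy (pathGraph n) =
      if Even n then 2 * csc (Real.pi / (2 * ((n : ℝ) + 1))) - 2
      else 2 * Real.cot (Real.pi / (2 * ((n : ℝ) + 1))) - 2 := by
  rw [adjEnergy_pathGraph]
  set θ : ℝ := Real.pi / (n + 1) with hθ
  have hn0 : (0 : ℝ) < n + 1 := by positivity
  have hθ0 : 0 < θ := by positivity
  have hθn : (n + 1) * θ = Real.pi := by rw [hθ]; field_simp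
  have hθ2 : Real.pi / (2 * ((n : ℝ) + 1)) = θ / 2 := by rw [hθ]; field_simp
  rw [hθ2]
  have hhalf : 0 < Real.sin (θ / 2) := by
    refine Real.sin_pos_of_pos_of_lt_pi (by linarith) ?_
    have : (0 : ℝ) ≤ n := Nat.cast_nonneg n
    nlinarith
  set g : ℕ → ℝ := fun k => |2 * Real.cos (((k : ℝ) + 1) * θ)| with hg
  -- The angles at `k` and `n - 1 - k` add up to π, so only the first half, where the cosines are
  -- nonnegative, has to be summed.
  have hrefl : ∀ k l : ℕ, k + l + 1 = n → g l = g k := by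
    intro k l h
    have h' : (k : ℝ) + l + 1 = n := by exact_mod_cast h
    simp only [hg]
    rw [show ((l : ℝ) + 1) * θ = Real.pi - (k + 1) * θ by rw [← hθn, ← h']; ring,
      Real.cos_pi_sub, mul_neg, abs_neg]
  have hsum : ∀ m : ℕ, 2 * m ≤ n → ∑ k ∈ Finset.range m, g k =
      Real.sin ((m + 1 / 2) * θ) / Real.sin (θ / 2) - 1 := by
    intro m hm
    have h1 : ∑ k ∈ Finset.range m, g k =
        ∑ k ∈ Finset.range m, 2 * Real.cos (((k : ℝ) + 1) * θ) := by
      refine Finset.sum_congr rfl fun k hk => abs_of_nonneg ?_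
      have hk : 2 * (k + 1) ≤ n := by
        have := Finset.mem_range.1 hk
        omega
      have hk' : 2 * ((k : ℝ) + 1) ≤ n := by exact_mod_cast hk
      refine mul_nonneg zero_le_two (Real.cos_nonneg_of_neg_pi_div_two_le_of_le ?_ ?_)
      · have : 0 ≤ ((k : ℝ) + 1) * θ := by positivity
        linarith [Real.pi_pos]
      · nlinarith
    have h2 := sum_two_mul_cos_mul_sin_half θ m
    rw [← h1] at h2
    rw [eq_sub_iff_add_eq, eq_div_iff hhalf.ne']
    linarith
  rcases Nat.even_or_odd' n with ⟨m, hm | hm⟩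
  · have hm' : (n : ℝ) = 2 * m := by exact_mod_cast hm
    rw [if_pos (hm ▸ even_two_mul m), csc]
    have : ∑ k ∈ Finset.range n, g k = 2 * ∑ k ∈ Finset.range m, g k := by
      rw [hm]
      exact sum_range_symm_even g m fun k hk => hrefl _ _ (by omega)
    rw [this, hsum m hm.ge, show ((m : ℝ) + 1 / 2) * θ = Real.pi / 2 by
      rw [← hθn, hm']; ring, Real.sin_pi_div_two]
    ring
  · have hm' : (n : ℝ) = 2 * m + 1 := by exact_mod_cast hm
    rw [if_neg (by rw [hm, Nat.not_even_iff_odd]; exact odd_two_mul_add_one m),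
      Real.cot_eq_cos_div_sin]
    have : ∑ k ∈ Finset.range n, g k = 2 * ∑ k ∈ Finset.range m, g k + g m := by
      rw [hm]
      exact sum_range_symm_odd g m fun k hk => hrefl _ _ (by omega)
    -- The middle angle is π/2.
    have hgm : g m = 0 := by
      simp only [hg]
      rw [show ((m : ℝ) + 1) * θ = Real.pi / 2 by rw [← hθn, hm']; ring, Real.cos_pi_div_two]
      simp
    rw [this, hsum m (by omega), hgm, show ((m : ℝ) + 1 / 2) * θ = Real.pi / 2 - θ / 2 by
      rw [← hθn, hm']; ring, Real.sin_pi_div_two_sub]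
    ring

end PathEnergy

/-! ### The two bounds for trees -/

section Main

open Matrix

variable {V : Type*} [Fintype V]

/-- Otherwise the degree sum 2(n - 1) would be at most n, forcing n ≤ 2. -/
theorem SimpleGraph.IsTree.two_le_maxDegree {T : SimpleGraph V} [DecidableRel T.Adj]
    (hT : T.IsTree) (h3 : 3 ≤ Fintype.card V) : 2 ≤ T.maxDegree := by
  by_contra! h
  have h1 := T.sum_degrees_eq_twice_card_edges
  have h2 := hT.card_edgeFinset
  have h4 : ∑ v, T.degree v ≤ ∑ _v : V, 1 :=
    Finset.sum_le_sum fun v _ => (T.degree_le_maxDegree v).trans (by omega)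
  simp at h4
  omega

theorem somborMatrix_sq_apply (G : SimpleGraph V) [DecidableRel G.Adj] (i j : V) :
    somborMatrix G i j ^ 2 =
      if G.Adj i j then (G.degree i : ℝ) ^ 2 + (G.degree j : ℝ) ^ 2 else 0 := by
  rw [somborMatrix, of_apply]
  split_ifs
  · exact Real.sq_sqrt (by positivity)
  · simp

theorem four_mul_lt_trace_somborMatrix_sq {T : SimpleGraph V} [DecidableRel T.Adj]
    (hT : T.IsTree) (h3 : 3 ≤ Fintype.card V) :
    4 * ((Fintype.card V : ℝ) - 1) < (somborMatrix T * somborMatrix T).trace := by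
  have hsum : ∑ v, (T.degree v : ℝ) * 2 = 4 * ((Fintype.card V : ℝ) - 1) := by
    have h1 := T.sum_degrees_eq_twice_card_edges
    have h2 := hT.card_edgeFinset
    have h1' : ∑ v, (T.degree v : ℝ) = 2 * (T.edgeFinset.card : ℝ) := by exact_mod_cast h1
    have h2' : (T.edgeFinset.card : ℝ) + 1 = Fintype.card V := by exact_mod_cast h2
    rw [← Finset.sum_mul, h1', ← h2']
    ring
  have hrow : ∀ i, (T.degree i : ℝ) * ((T.degree i : ℝ) ^ 2 + 1) ≤
      (somborMatrix T * somborMatrix T) i i := by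
    intro i
    rw [Matrix.mul_apply]
    have h1 : ∀ j, (if T.Adj i j then (T.degree i : ℝ) ^ 2 + 1 else 0) ≤
        somborMatrix T i j * somborMatrix T j i := by
      intro j
      have hs : somborMatrix T j i = somborMatrix T i j := by
        simpa using (somborMatrix_isHermitian T).apply i j
      rw [hs, ← sq, somborMatrix_sq_apply]
      split_ifs with h
      · have : 1 ≤ T.degree j := (T.degree_pos_iff_exists_adj j).2 ⟨i, h.symm⟩
        have : (1 : ℝ) ≤ T.degree j := by exact_mod_cast this
        nlinarith
      · exact le_rfl
    refine le_trans (le_of_eq ?_) (Finset.sum_le_sum fun j _ => h1 j)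
    rw [← Finset.sum_filter, Finset.sum_const, nsmul_eq_mul, ← T.card_neighborFinset_eq_degree,
      T.neighborFinset_eq_filter]
  rw [← hsum, Matrix.trace]
  have hV : Nonempty V := Fintype.card_pos_iff.1 (by omega)
  obtain ⟨w, hw⟩ := T.exists_maximal_degree_vertex
  have hw2 : (2 : ℝ) ≤ T.degree w := by exact_mod_cast hw ▸ hT.two_le_maxDegree h3
  -- Termwise, d(d² + 1) ≥ 2d for every natural number d, strictly at the vertex `w` of degree at
  -- least 2.
  refine Finset.sum_lt_sum (fun i _ => ?_) ⟨w, Finset.mem_univ w, ?_⟩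
  · refine le_trans ?_ (hrow i)
    rcases Nat.eq_zero_or_pos (T.degree i) with h | h
    · simp [h]
    · have : (1 : ℝ) ≤ T.degree i := by exact_mod_cast h
      exact mul_le_mul_of_nonneg_left (by nlinarith) (by linarith)
  · exact lt_of_lt_of_le (mul_lt_mul_of_pos_left (by nlinarith) (by linarith)) (hrow w)

variable [DecidableEq V]

theorem lt_somborEnergy_of_isTree {T : SimpleGraph V} [DecidableRel T.Adj]
    (hT : T.IsTree) (h3 : 3 ≤ Fintype.card V) :
    2 * √(2 * (Fintype.card V : ℝ) - 2) < somborEnergy T := by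
  have h0 : (somborMatrix T).trace = 0 := by simp [Matrix.trace, somborMatrix]
  have h1 := two_mul_trace_sq_le_energy_sq (somborMatrix_isHermitian T) h0
  have h2 := four_mul_lt_trace_somborMatrix_sq hT h3
  have hn : (3 : ℝ) ≤ Fintype.card V := by exact_mod_cast h3
  refine lt_of_pow_lt_pow_left₀ 2 (Finset.sum_nonneg fun _ _ => abs_nonneg _) ?_
  rw [mul_pow, Real.sq_sqrt (by linarith), somborEnergy]
  linarith

theorem SimpleGraph.Colorable.exists_signing {V : Type*} {G : SimpleGraph V} (hG : G.Colorable 2) :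
    ∃ σ : V → ℝ, (∀ i, σ i ^ 2 = 1) ∧ ∀ i j, G.Adj i j → σ j = -σ i := by
  obtain ⟨c⟩ := hG
  refine ⟨fun v => if c v = 0 then 1 else -1, fun i => by dsimp only; split_ifs <;> norm_num,
    fun i j hij => ?_⟩
  have h := c.valid hij
  by_cases hi : c i = 0
  · have : c j ≠ 0 := fun h' => h (by rw [hi, h'])
    simp [hi, this]
  · have : c j = 0 := by omega
    simp [hi, this]

theorem pathGraph_exists_signing (n : ℕ) :
    ∃ σ : Fin n → ℝ, (∀ i, σ i ^ 2 = 1) ∧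
      ∀ i j, (SimpleGraph.pathGraph n).Adj i j → σ j = -σ i := by
  refine ⟨fun i => (-1) ^ i.1, fun i => by simp [← pow_mul], fun i j hij => ?_⟩
  rcases SimpleGraph.pathGraph_adj.1 hij with h | h
  · simp only [← h, pow_succ]
    ring
  · simp only [← h, pow_succ]
    ring

theorem prod_eigenvalues_pathGraph (n : ℕ) (t : ℝ) :
    ∏ i, (1 + ((adjMatrix_real_isHermitian (SimpleGraph.pathGraph n)).eigenvalues i * t) ^ 2) =
      pathMatchingPoly (t ^ 2) n ^ 2 := by
  obtain ⟨σ, hσ1, hσ⟩ := pathGraph_exists_signing n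
  rw [← det_one_add_smul_mul_self, det_one_add_smul_mul_self_of_signing
    (adjMatrix_real_isHermitian _) σ hσ1 ?_, det_signed_pathGraph n σ hσ1 hσ]
  intro i j hij
  refine hσ i j ?_
  by_contra h
  simp [h] at hij

theorem prod_eigenvalues_somborMatrix_lt {T : SimpleGraph V} [DecidableRel T.Adj]
    (hT : T.IsTree) (h3 : 3 ≤ Fintype.card V) {t : ℝ} (ht : 0 < t) :
    ∏ i, (1 + ((somborMatrix_isHermitian T).eigenvalues i * t) ^ 2) <
      pathMatchingPoly ((√2 * T.maxDegree * t) ^ 2) (Fintype.card V) ^ 2 := by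
  obtain ⟨σ, hσ1, hσ⟩ := hT.colorable_two.exists_signing
  have hadj : ∀ i j, ¬ T.Adj i j → somborMatrix T i j = 0 := fun i j h => by
    simp [somborMatrix, h]
  rw [← det_one_add_smul_mul_self, det_one_add_smul_mul_self_of_signing
    (somborMatrix_isHermitian T) σ hσ1 fun i j hij => hσ i j (by_contra fun h => hij (hadj i j h))]
  have hΔ : (2 : ℝ) ≤ T.maxDegree := by exact_mod_cast hT.two_le_maxDegree h3
  have hc : (√2 * T.maxDegree * t) ^ 2 = t ^ 2 * (2 * (T.maxDegree : ℝ) ^ 2) := by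
    rw [mul_pow, mul_pow, Real.sq_sqrt zero_le_two]
    ring
  have hdeg : ∀ i, (T.degree i : ℝ) ^ 2 ≤ (T.maxDegree : ℝ) ^ 2 := fun i =>
    pow_le_pow_left₀ (Nat.cast_nonneg _) (by exact_mod_cast T.degree_le_maxDegree i) 2
  set K : Matrix V V ℝ := t • of fun i j => σ i * somborMatrix T i j with hK
  have hKsq : ∀ i j, K i j ^ 2 = t ^ 2 * somborMatrix T i j ^ 2 := fun i j => by
    simp only [hK, Matrix.smul_apply, of_apply, smul_eq_mul, mul_pow, hσ1 i, one_mul]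
  have : Nontrivial V := Fintype.one_lt_card_iff_nontrivial.1 (by omega)
  obtain ⟨v, hv⟩ := hT.exists_vert_degree_one_of_nontrivial
  obtain ⟨u, hu, huniq⟩ := (SimpleGraph.degree_eq_one_iff_existsUnique_adj).1 hv
  have hdet := det_lt_pathMatchingPoly hT.isAcyclic K (fun i j => ?_) (fun i j h => ?_)
    (c := (√2 * T.maxDegree * t) ^ 2) (fun i j => ?_) hu.symm huniq ?_
  · exact pow_lt_pow_left₀ hdet.2 (zero_le_one.trans hdet.1) two_ne_zero
  · have hs : somborMatrix T j i = somborMatrix T i j := by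
      simpa using (somborMatrix_isHermitian T).apply i j
    simp only [hK, Matrix.smul_apply, of_apply, smul_eq_mul, hs]
    by_cases h : T.Adj i j
    · rw [hσ i j h]
      ring
    · simp [hadj i j h]
  · simp [hK, hadj i j h]
  · rw [hKsq, hc, somborMatrix_sq_apply]
    refine mul_le_mul_of_nonneg_left ?_ (sq_nonneg t)
    split_ifs
    · linarith [hdeg i, hdeg j]
    · positivity
  -- At the leaf edge, d_u² + 1 ≤ Δ² + 1 < 2Δ² because Δ ≥ 2.
  · rw [hKsq, hc, somborMatrix_sq_apply, if_pos (show T.Adj u v from hu.symm), hv]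
    refine mul_lt_mul_of_pos_left ?_ (pow_pos ht 2)
    have := hdeg u
    norm_num
    nlinarith

theorem somborEnergy_lt_of_isTree {T : SimpleGraph V} [DecidableRel T.Adj]
    (hT : T.IsTree) (h3 : 3 ≤ Fintype.card V) :
    somborEnergy T <
      √2 * (T.maxDegree : ℝ) * adjEnergy (SimpleGraph.pathGraph (Fintype.card V)) := by
  have hc : 0 ≤ √2 * (T.maxDegree : ℝ) := by positivity
  have h := sum_abs_lt_of_prod_lt (somborMatrix_isHermitian T).eigenvalues
    (fun i => √2 * (T.maxDegree : ℝ) *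
      (adjMatrix_real_isHermitian (SimpleGraph.pathGraph (Fintype.card V))).eigenvalues i)
    fun t ht => by
      refine (prod_eigenvalues_somborMatrix_lt hT h3 ht).trans_eq ?_
      -- Evaluating the path polynomial at `√2 * Δ * t` amounts to scaling the path eigenvalues by
      -- `√2 * Δ`.
      rw [← prod_eigenvalues_pathGraph]
      exact Finset.prod_congr rfl fun i _ => by ring
  simp only [abs_mul _ (IsHermitian.eigenvalues _ _), abs_of_nonneg hc, ← Finset.mul_sum] at h
  exact h

end Main

theorem theorem4p7 {V : Type*} [Fintype V] [DecidableEq V] (T : SimpleGraph V)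
    [DecidableRel T.Adj] (hT : T.IsTree)
    (n Δ : ℕ) (hn : Fintype.card V = n) (hn3 : 3 ≤ n) (hΔ : T.maxDegree = Δ) :
    2 * √(2 * (n : ℝ) - 2) < somborEnergy T ∧
    somborEnergy T < √2 * (Δ : ℝ) * adjEnergy (SimpleGraph.pathGraph n) ∧
    √2 * (Δ : ℝ) * adjEnergy (SimpleGraph.pathGraph n) =
      if Even n then
        2 * √2 * (Δ : ℝ) * csc (Real.pi / (2 * ((n : ℝ) + 1))) - 2 * √2 * (Δ : ℝ)
      else
        2 * √2 * (Δ : ℝ) * Real.cot (Real.pi / (2 * ((n : ℝ) + 1))) - 2 * √2 * (Δ : ℝ) := by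
  subst hn hΔ
  refine ⟨lt_somborEnergy_of_isTree hT hn3, somborEnergy_lt_of_isTree hT hn3, ?_⟩
  rw [adjEnergy_pathGraph_eq]
  split_ifs <;> ring
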